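/- Let $k\ge 3$ be an integer, let $\beta>\frac{2k-3}{k-2}$ and $0<\varepsilon<(k-1)\frac{\beta-2}{\beta-1}-1$ be real constants. For $n,m\in\mathbb N$, a random power-law $k$-SAT formula $\Phi$ with $n$ variables and $m$ clauses is drawn as follows: variable $i\in\{1,\dots,n\}$ has weight $w_i=i^{-1/(\beta-1)}$; the $m$ clauses are sampled independently; each clause is sampled by drawing $k$ variables one after the other, without repetition, each time with probabilities proportional to the weights, and then negating each of the $k$ variables independently with probability $1/2$. A tree-like resolution refutation of $\Phi$ is a binary tree whose nodes are labelled by clauses, whose leaves are labelled by clauses of $\Phi$, in which each inner node is labelled by the resolvent $(C\setminus\{x\})\cup(D\setminus\{\neg x\})$ of the labels $C\ni x$ and $D\ni\neg x$ of its two children, and whose root is labelled by the empty clause. Its size is its number of nodes. The tree-like resolution size $S_T(\Phi)$ is the minimum size of a tree-like resolution refutation of $\Phi$, with $S_T(\Phi)=\infty$ if $\Phi$ is satisfiable. There is a constant $C>0$, depending only on $k,\beta,\varepsilon$, such that the following holds. Let $m=m(n)\in\Omega(n)$, let $\Delta=m/n$ satisfy $\Delta\in o\big((n/\log n)^{\varepsilon}\big)$,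 and suppose that the density is large enough that $\Phi$ is unsatisfiable with at least constant probability, i.e. for some $p>0$, $\Pr[\Phi\text{ is unsatisfiable}]\ge p$ for all sufficiently large $n$. Then asymptotically almost surely $\Phi$ has tree-like resolution size $\exp\big(\Omega(n\cdot\Delta^{-1/\varepsilon})\big)$, both unconditionally and conditioned on unsatisfiability: $$\Pr\big[S_T(\Phi)\ge \exp(C\,n\,\Delta^{-1/\varepsilon})\big]\to 1 \quad\text{and}\quad \Pr\big[S_T(\Phi)\ge \exp(C\,n\,\Delta^{-1/\varepsilon})\ \big|\ \Phi\text{ is unsatisfiable}\big]\to 1\qquad(n\to\infty).$$ -/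

import Mathlib

open Filter Topology Asymptotics

namespace PowerLawSAT

/-- A literal over the variables `V`: the pair `(x, true)` is the literal `x` and `(x, false)` is
its negation. -/
abbrev Literal (V : Type) : Type := V × Bool

/-- A clause: a finite set (disjunction) of literals. -/
abbrev Clause (V : Type) : Type := Finset (Literal V)

/-- A CNF formula with `n` variables and `m` (indexed, possibly repeated) clauses. -/
abbrev CNF (n m : ℕ) : Type := Fin m → Clause (Fin n)

/-- The formula has no satisfying assignment: every assignment falsifies all literals of some
clause. -/
def Unsat {n m : ℕ} (Φ : CNF n m) : Prop :=
  ∀ a : Fin n → Bool, ∃ i : Fin m, ∀ l ∈ Φ i, a l.1 ≠ l.2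

/-! ### Tree-like resolution -/

/-- Tree-like resolution derivations from the set `F` of clauses. A term of type
`TreeDerivation F E` is a binary tree whose root is labelled by `E`, whose leaves are labelled by
clauses of `F`, and whose inner nodes are labelled by the resolvent of the labels of their two
children: from `C` containing `x` and `D` containing `¬x` infer `(C \ {x}) ∪ (D \ {¬x})`. -/
inductive TreeDerivation {V : Type} [DecidableEq V] (F : Set (Clause V)) : Clause V → Type where
  | leaf (C : Clause V) (hC : C ∈ F) : TreeDerivation F C
  | resolve (x : V) (C D : Clause V) (hC : (x, true) ∈ C) (hD : (x, false) ∈ D)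
      (left : TreeDerivation F C) (right : TreeDerivation F D) :
      TreeDerivation F (C.erase (x, true) ∪ D.erase (x, false))

/-- The size of a tree-like derivation: the number of clauses (nodes of the tree) in it. -/
def TreeDerivation.size {V : Type} [DecidableEq V] {F : Set (Clause V)} :
    {E : Clause V} → TreeDerivation F E → ℕ
  | _, .leaf _ _ => 1
  | _, .resolve _ _ _ _ _ left right => left.size + right.size + 1

/-- The tree-like resolution size of a formula: the least size of a tree-like derivation of the
empty clause from its clauses (`⊤` if there is none, i.e. if the formula is satisfiable). -/
noncomputable def treeLikeSize {n m : ℕ} (Φ : CNF n m) : ℕ∞ :=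
  ⨅ π : TreeDerivation (Set.range Φ) ∅, (π.size : ℕ∞)

/-! ### The non-uniform and the power-law random `k`-SAT model -/

/-- The variables drawn strictly before step `j`. -/
def drawnBefore {n k : ℕ} (v : Fin k → Fin n) (j : Fin k) : Finset (Fin n) :=
  (Finset.univ.filter (fun i : Fin k => i < j)).image v

/-- The probability that drawing `k` variables one after the other, without repetition and each
time with probabilities proportional to the weights `w`, produces the sequence `v`
(probability `0` if `v` has a repetition). -/
noncomputable def drawProb {n k : ℕ} (w : Fin n → ℝ) (v : Fin k → Fin n) : ℝ :=
  ∏ j : Fin k, if v j ∈ drawnBefore v j then 0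
    else w (v j) / ∑ u ∈ Finset.univ \ drawnBefore v j, w u

/-- The probability that the random clause is drawn as the sequence `c` of literals: the underlying
variables are drawn without repetition, and each of them is negated independently with
probability `1 / 2`. -/
noncomputable def clauseProb {n k : ℕ} (w : Fin n → ℝ) (c : Fin k → Literal (Fin n)) : ℝ :=
  drawProb w (fun j => (c j).1) * (1 / 2) ^ k

/-- The formula given by `m` drawn sequences of `k` literals. -/
def toCNF {n m k : ℕ} (d : Fin m → Fin k → Literal (Fin n)) : CNF n m :=
  fun i => Finset.univ.image (d i)

/-- The probability of the event `S` for a random formula of the non-uniform `k`-SAT model with `n`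
variables of weights `w` and `m` independently drawn clauses. -/
noncomputable def prob {n m : ℕ} (k : ℕ) (w : Fin n → ℝ) (S : Set (CNF n m)) : ℝ :=
  ∑ d : Fin m → Fin k → Literal (Fin n),
    (toCNF ⁻¹' S).indicator (fun d => ∏ i : Fin m, clauseProb w (d i)) d

/-- The power-law weights `w_i = i ^ (-1 / (β - 1))`, `1 ≤ i ≤ n` (the index `i : Fin n` starts
at `0`). -/
noncomputable def powerLawWeight (β : ℝ) (n : ℕ) (i : Fin n) : ℝ :=
  ((i : ℝ) + 1) ^ (-1 / (β - 1))

end PowerLawSAT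

namespace PowerLawSAT

/-! ### Expansion forces large tree-like refutations -/

/-! The bound is deterministic once the formula expands, and a random power-law formula expands with
high probability.

Deterministic part (`IsPosition.query`, `IsPosition.two_pow_le_size`). Suppose every set of at most
r clauses has at least 1 + δ variables per clause. A delayer walks down the refutation from the
root, keeping Hall's condition for the clauses not yet satisfied. If both values of a queried
variable preserve it, a point is scored and both subtrees can be followed. Otherwise a tight set of
clauses is satisfied through a matching, at no point. Expansion prevents a falsified clause before
δr points are scored, so the tree has at least 2^t nodes for every t < δr.

Probabilistic part (`prob_card_varsOf_lt_le`, `choose_mul_le`). Let τ bound the draw weight of any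
ks variables. Each draw either repeats a variable, with weight at most τ, or multiplies τ^(number of
variables) by τ. Thus the expectation of τ^|vars R| for s clauses is at most (3τ)^(ks), and Markov's
inequality bounds the chance of having few variables. With α = 1/(β - 1), x = s/n and Δ = m/n,
power-law weights allow τ of order x^(1-α). The union bound is then a sum of s-th powers of a
constant times Δ x^((1-α)(k-1-δ)-1). The condition on ε leaves a spare factor x^δ as long as Δ x^ε
is small, that is, up to r of order n Δ^(-1/ε). The failure probability is at most 2n^(-δ), which
survives division by p when conditioning. -/

/-- The variables occurring in the clauses with index in `R`. -/
def varsOf {n m : ℕ} (Φ : CNF n m) (R : Finset (Fin m)) : Finset (Fin n) :=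
  R.biUnion fun i => (Φ i).image Prod.fst

/-- Every set of at most `r` clauses contains at least `1 + δ` variables per clause. -/
def IsExpander {n m : ℕ} (Φ : CNF n m) (r : ℕ) (δ : ℝ) : Prop :=
  ∀ R : Finset (Fin m), R.card ≤ r → (1 + δ) * R.card ≤ (varsOf Φ R).card

/-- A position of the delayer in the prover-delayer game on `Φ`: the variables in `A` are assigned
by `σ`, the clauses in `T` are satisfied, `s` points have been scored, and the remaining clauses
satisfy Hall's condition with respect to the unassigned variables, up to size `r`. -/
structure IsPosition {n m : ℕ} (Φ : CNF n m) (r : ℕ) (A : Finset (Fin n)) (σ : Fin n → Bool)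
    (T : Finset (Fin m)) (s : ℕ) : Prop where
  sat : ∀ i ∈ T, ∃ l ∈ Φ i, l.1 ∈ A ∧ σ l.1 = l.2
  vars : varsOf Φ T ⊆ A
  card : A.card ≤ T.card + s
  le : T.card ≤ r
  hall : ∀ R : Finset (Fin m), Disjoint T R → T.card + R.card ≤ r →
    R.card ≤ (varsOf Φ R \ A).card

theorem varsOf_union {n m : ℕ} (Φ : CNF n m) (R S : Finset (Fin m)) :
    varsOf Φ (R ∪ S) = varsOf Φ R ∪ varsOf Φ S := by
  simp [varsOf, Finset.union_biUnion]

theorem IsExpander.initial {n m r : ℕ} {Φ : CNF n m} {δ : ℝ} (hδ : 0 < δ)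
    (h : IsExpander Φ r δ) (σ : Fin n → Bool) : IsPosition Φ r ∅ σ ∅ 0 := by
  refine ⟨by simp, by simp [varsOf], by simp, by simp, fun R _ hR => ?_⟩
  have := h R (by simpa using hR)
  have h2 : (R.card : ℝ) ≤ (varsOf Φ R).card := by
    nlinarith [(Nat.cast_nonneg R.card : (0 : ℝ) ≤ R.card)]
  simpa using (by exact_mod_cast h2 : R.card ≤ (varsOf Φ R).card)

/-- Expansion gives (1 + δ)|T| ≤ |A| ≤ |T| + s, hence δ|T| ≤ s. With few points there is therefore
room for one more clause in `hall`. -/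
theorem IsPosition.card_lt {n m r s : ℕ} {Φ : CNF n m} {δ : ℝ} (hδ : 0 < δ)
    (h : IsExpander Φ r δ) {A : Finset (Fin n)} {σ : Fin n → Bool} {T : Finset (Fin m)}
    (hp : IsPosition Φ r A σ T s) (hs : (s : ℝ) < δ * r) : T.card < r := by
  have h1 := h T hp.le
  have h2 : ((varsOf Φ T).card : ℝ) ≤ T.card + s := by
    exact_mod_cast (Finset.card_le_card hp.vars).trans hp.card
  have h3 : δ * T.card < δ * r := by linarith
  exact_mod_cast lt_of_mul_lt_mul_left h3 hδ.le

/-- No clause is falsified in a position with few points. -/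
theorem IsPosition.not_falsified {n m r s : ℕ} {Φ : CNF n m} {δ : ℝ} (hδ : 0 < δ)
    (h : IsExpander Φ r δ) {A : Finset (Fin n)} {σ : Fin n → Bool} {T : Finset (Fin m)}
    (hp : IsPosition Φ r A σ T s) (hs : (s : ℝ) < δ * r) (i : Fin m) :
    ¬ ∀ l ∈ Φ i, l.1 ∈ A ∧ σ l.1 ≠ l.2 := by
  intro hf
  by_cases hi : i ∈ T
  · obtain ⟨l, hl, -, hσ⟩ := hp.sat i hi
    exact (hf l hl).2 hσ
  · have h1 := hp.hall {i} (by simpa using hi) (by simpa using hp.card_lt hδ h hs)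
    have h2 : varsOf Φ {i} \ A = ∅ := by
      rw [Finset.sdiff_eq_empty_iff_subset]
      intro v hv
      simp only [varsOf, Finset.singleton_biUnion, Finset.mem_image] at hv
      obtain ⟨l, hl, rfl⟩ := hv
      exact (hf l hl).1
    simp [h2] at h1

/-- The delayer answers a query of an unassigned variable: either both values are possible, or the
variable becomes assigned without a point. -/
theorem IsPosition.query {n m r s : ℕ} {Φ : CNF n m} {A : Finset (Fin n)} {σ : Fin n → Bool}
    {T : Finset (Fin m)} (hp : IsPosition Φ r A σ T s) (x : Fin n) (hx : x ∉ A) :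
    (∀ b, IsPosition Φ r (insert x A) (Function.update σ x b) T (s + 1)) ∨
      ∃ A' σ' T', A ⊆ A' ∧ x ∈ A' ∧ (∀ v ∈ A, σ' v = σ v) ∧ IsPosition Φ r A' σ' T' s := by
  classical
  -- Either assigning `x` breaks Hall's condition on some `S`, or the value of `x` is free.
  by_cases hS : ∃ S : Finset (Fin m), Disjoint T S ∧ T.card + S.card ≤ r ∧
      (varsOf Φ S \ insert x A).card < S.card
  · right
    obtain ⟨S, hTS, hSr, hlt⟩ := hS
    have hhall := hp.hall S hTS hSr
    have hxS : x ∈ varsOf Φ S := by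
      by_contra hxS
      rw [Finset.sdiff_insert_of_notMem hxS] at hlt
      omega
    -- Removing the single variable `x` lowers the count by at most one, so `S` is tight. Hence
    -- adding its variables to `A` costs no point.
    have htight : (varsOf Φ S \ A).card ≤ S.card := by
      have : varsOf Φ S \ A ⊆ insert x (varsOf Φ S \ insert x A) := by
        intro v hv
        simp only [Finset.mem_sdiff, Finset.mem_insert] at hv ⊢
        tauto
      have := (Finset.card_le_card this).trans (Finset.card_insert_le _ _)
      omega
    -- Hall's theorem gives each clause of `S` a private unassigned variable, which can be set to
    -- satisfy it.
    obtain ⟨f, hf, hfm⟩ := (Finset.all_card_le_biUnion_card_iff_exists_injective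
      (fun i : {i // i ∈ S} => (Φ i).image Prod.fst \ A)).1 (by
        intro R
        have hR : R.map (Function.Embedding.subtype _) ⊆ S := by
          intro i hi
          simp only [Finset.mem_map, Function.Embedding.subtype_apply] at hi
          obtain ⟨j, -, rfl⟩ := hi
          exact j.2
        have := hp.hall (R.map (Function.Embedding.subtype _))
          (hTS.mono_right hR) ((Nat.add_le_add_left (Finset.card_le_card hR) _).trans hSr)
        rw [Finset.card_map] at this
        refine this.trans (Finset.card_le_card ?_)
        intro v hv
        simp only [varsOf, Finset.mem_sdiff, Finset.mem_biUnion, Finset.mem_map] at hv ⊢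
        obtain ⟨⟨i, ⟨j, hj, rfl⟩, hv⟩, hvA⟩ := hv
        exact ⟨j, hj, hv, hvA⟩)
    have hb : ∀ i : {i // i ∈ S}, ∃ b, (f i, b) ∈ Φ i := by
      intro i
      have := hfm i
      simp only [Finset.mem_sdiff, Finset.mem_image] at this
      obtain ⟨⟨l, hl, hlf⟩, -⟩ := this
      exact ⟨l.2, by rw [← hlf]; exact hl⟩
    choose b hb using hb
    have hfS : ∀ i, f i ∈ varsOf Φ S ∧ f i ∉ A := fun i => by
      have := Finset.mem_sdiff.1 (hfm i)
      exact ⟨Finset.mem_biUnion.2 ⟨i, i.2, this.1⟩, this.2⟩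
    have hσA : ∀ v ∈ A, Function.extend f b σ v = σ v := by
      intro v hv
      apply Function.extend_apply'
      rintro ⟨i, rfl⟩
      exact (hfS i).2 hv
    refine ⟨A ∪ varsOf Φ S, Function.extend f b σ, T ∪ S, Finset.subset_union_left,
      Finset.mem_union_right _ hxS, hσA, ?_, ?_, ?_, ?_, ?_⟩
    · intro i hi
      by_cases hiT : i ∈ T
      · obtain ⟨l, hl, hlA, hlσ⟩ := hp.sat i hiT
        exact ⟨l, hl, Finset.mem_union_left _ hlA, by rw [hσA _ hlA, hlσ]⟩
      · have hiS : i ∈ S := (Finset.mem_union.1 hi).resolve_left hiT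
        exact ⟨(f ⟨i, hiS⟩, b ⟨i, hiS⟩), hb ⟨i, hiS⟩,
          Finset.mem_union_right _ (hfS _).1, hf.extend_apply _ _ _⟩
    · rw [varsOf_union]
      exact Finset.union_subset_union_left hp.vars
    · rw [Finset.card_union_of_disjoint hTS, ← Finset.union_sdiff_self_eq_union]
      have := Finset.card_union_le A (varsOf Φ S \ A)
      have := hp.card
      omega
    · rwa [Finset.card_union_of_disjoint hTS]
    -- Hall's condition for `S ∪ R` minus the tight count for `S` leaves Hall's condition for `R`
    -- outside the variables of `S`.
    · intro R hR hRr
      rw [Finset.card_union_of_disjoint hTS] at hRr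
      rw [Finset.disjoint_union_left] at hR
      have h1 := hp.hall (S ∪ R) (Finset.disjoint_union_right.2 ⟨hTS, hR.1⟩) (by
        rw [Finset.card_union_of_disjoint hR.2]; omega)
      rw [Finset.card_union_of_disjoint hR.2, varsOf_union] at h1
      have h2 : (varsOf Φ S ∪ varsOf Φ R) \ A ⊆
          (varsOf Φ S \ A) ∪ (varsOf Φ R \ (A ∪ varsOf Φ S)) := by
        intro v hv
        simp only [Finset.mem_sdiff, Finset.mem_union] at hv ⊢
        tauto
      have h3 := (Finset.card_le_card h2).trans (Finset.card_union_le _ _)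
      omega
  · left
    push Not at hS
    intro b
    have hσA : ∀ v ∈ A, Function.update σ x b v = σ v := fun v hv =>
      Function.update_of_ne (by rintro rfl; exact hx hv) _ _
    refine ⟨fun i hi => ?_, hp.vars.trans (Finset.subset_insert _ _), ?_, hp.le, hS⟩
    · obtain ⟨l, hl, hlA, hlσ⟩ := hp.sat i hi
      exact ⟨l, hl, Finset.mem_insert_of_mem hlA, by rw [hσA _ hlA, hlσ]⟩
    · rw [Finset.card_insert_of_notMem hx]
      have := hp.card
      omega

/-- The falsified clause `E` is the node reached by the game and `t` is the number of points still
available. A scored point branches into both children and doubles the bound; a forced answer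
descends to one child with the same `t`. -/
theorem IsPosition.two_pow_le_size {n m r : ℕ} {Φ : CNF n m} {δ : ℝ} (hδ : 0 < δ)
    (h : IsExpander Φ r δ) {E : Clause (Fin n)} (π : TreeDerivation (Set.range Φ) E) :
    ∀ {A : Finset (Fin n)} {σ : Fin n → Bool} {T : Finset (Fin m)} {s : ℕ} (t : ℕ),
      IsPosition Φ r A σ T s → ((s + t : ℕ) : ℝ) < δ * r →
      (∀ l ∈ E, l.1 ∈ A ∧ σ l.1 ≠ l.2) → 2 ^ t ≤ π.size := by
  induction π with
  | leaf C hC =>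
    intro A σ T s t hp hst hE
    obtain ⟨i, rfl⟩ := hC
    refine absurd hE (hp.not_falsified hδ h (lt_of_le_of_lt ?_ hst) i)
    exact_mod_cast Nat.le_add_right s t
  | resolve x C D hC hD left right ihl ihr =>
    intro A σ T s t hp hst hE
    have assigned : ∀ {A : Finset (Fin n)} {σ : Fin n → Bool} {T : Finset (Fin m)},
        IsPosition Φ r A σ T s → x ∈ A →
        (∀ l ∈ C.erase (x, true) ∪ D.erase (x, false), l.1 ∈ A ∧ σ l.1 ≠ l.2) →
        2 ^ t ≤ (TreeDerivation.resolve x C D hC hD left right).size := by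
      intro A σ T hp hx hE
      rw [TreeDerivation.size]
      cases hσ : σ x with
      | false =>
        have := ihl t hp hst (fun l hl => by
          by_cases hlx : l = (x, true)
          · subst hlx
            exact ⟨hx, by simp [hσ]⟩
          · exact hE l (Finset.mem_union_left _ (Finset.mem_erase.2 ⟨hlx, hl⟩)))
        omega
      | true =>
        have := ihr t hp hst (fun l hl => by
          by_cases hlx : l = (x, false)
          · subst hlx
            exact ⟨hx, by simp [hσ]⟩
          · exact hE l (Finset.mem_union_right _ (Finset.mem_erase.2 ⟨hlx, hl⟩)))
        omega
    by_cases hx : x ∈ A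
    · exact assigned hp hx hE
    rcases hp.query x hx with hq | ⟨A', σ', T', hAA, hxA, hσ, hp'⟩
    · rw [TreeDerivation.size]
      cases t with
      | zero => simp
      | succ t =>
        have hst' : ((s + 1 + t : ℕ) : ℝ) < δ * r := by
          rwa [show s + 1 + t = s + (t + 1) by omega]
        have falsified : ∀ (b : Bool) (G : Clause (Fin n)),
            (∀ l ∈ G.erase (x, b), l.1 ∈ A ∧ σ l.1 ≠ l.2) →
            ∀ l ∈ G, l.1 ∈ insert x A ∧ Function.update σ x (!b) l.1 ≠ l.2 := by
          intro b G hG l hl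
          by_cases hlx : l = (x, b)
          · subst hlx
            exact ⟨Finset.mem_insert_self _ _, by simp⟩
          · obtain ⟨hlA, hlσ⟩ := hG l (Finset.mem_erase.2 ⟨hlx, hl⟩)
            refine ⟨Finset.mem_insert_of_mem hlA, ?_⟩
            rwa [Function.update_of_ne (by rintro hh; exact hx (hh ▸ hlA))]
        have h1 := ihl t (hq false) hst' (falsified true C
          fun l hl => hE l (Finset.mem_union_left _ hl))
        have h2 := ihr t (hq true) hst' (falsified false D
          fun l hl => hE l (Finset.mem_union_right _ hl))
        rw [pow_succ]
        omega
    · exact assigned hp' hxA fun l hl => ⟨hAA (hE l hl).1, by rw [hσ _ (hE l hl).1]; exact (hE l hl).2⟩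

theorem IsExpander.two_pow_le_treeLikeSize {n m r t : ℕ} {Φ : CNF n m} {δ : ℝ} (hδ : 0 < δ)
    (h : IsExpander Φ r δ) (ht : (t : ℝ) < δ * r) : ((2 ^ t : ℕ) : ℕ∞) ≤ treeLikeSize Φ := by
  refine le_iInf fun π => ?_
  exact_mod_cast IsPosition.two_pow_le_size hδ h π t (h.initial hδ fun _ => false)
    (by simpa using ht) (by simp)

/-! ### The random model as a finite probability space -/

theorem drawnBefore_snoc_castSucc {n k : ℕ} (v : Fin k → Fin n) (x : Fin n) (j : Fin k) :
    drawnBefore (Fin.snoc v x : Fin (k + 1) → Fin n) j.castSucc = drawnBefore v j := by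
  ext u
  simp only [drawnBefore, Finset.mem_image, Finset.mem_filter, Finset.mem_univ, true_and]
  constructor
  · rintro ⟨i, hi, rfl⟩
    refine ⟨i.castLT (lt_trans hi j.2), hi, ?_⟩
    rw [← Fin.snoc_castSucc (α := fun _ => Fin n) x v]
    simp
  · rintro ⟨i, hi, rfl⟩
    exact ⟨i.castSucc, hi, by simp⟩

theorem drawnBefore_snoc_last {n k : ℕ} (v : Fin k → Fin n) (x : Fin n) :
    drawnBefore (Fin.snoc v x : Fin (k + 1) → Fin n) (Fin.last k) = Finset.univ.image v := by
  ext u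
  simp only [drawnBefore, Finset.mem_image, Finset.mem_filter, Finset.mem_univ, true_and]
  constructor
  · rintro ⟨i, hi, rfl⟩
    refine ⟨i.castLT hi, ?_⟩
    rw [← Fin.snoc_castSucc (α := fun _ => Fin n) x v]
    simp
  · rintro ⟨i, rfl⟩
    exact ⟨i.castSucc, Fin.castSucc_lt_last i, by simp⟩

theorem drawProb_snoc {n k : ℕ} (w : Fin n → ℝ) (v : Fin k → Fin n) (x : Fin n) :
    drawProb w (Fin.snoc v x : Fin (k + 1) → Fin n) = drawProb w v *
      if x ∈ Finset.univ.image v then 0 else w x / ∑ u ∈ Finset.univ \ Finset.univ.image v, w u := by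
  unfold drawProb
  rw [Fin.prod_univ_castSucc]
  simp only [drawnBefore_snoc_castSucc, drawnBefore_snoc_last, Fin.snoc_castSucc, Fin.snoc_last]

theorem drawProb_nonneg {n k : ℕ} {w : Fin n → ℝ} (hw : ∀ i, 0 < w i) (v : Fin k → Fin n) :
    0 ≤ drawProb w v := by
  refine Finset.prod_nonneg fun j _ => ?_
  split_ifs
  · rfl
  · exact div_nonneg (hw _).le (Finset.sum_nonneg fun u _ => (hw u).le)

theorem sum_drawProb {n : ℕ} {w : Fin n → ℝ} (hw : ∀ i, 0 < w i) (k : ℕ) (hk : k ≤ n) :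
    ∑ v : Fin k → Fin n, drawProb w v = 1 := by
  induction k with
  | zero => simp [drawProb]
  | succ k ih =>
    rw [← (Fin.snocEquiv (fun _ : Fin (k + 1) => Fin n)).sum_comp, Fintype.sum_prod_type_right]
    rw [← ih (by omega)]
    refine Finset.sum_congr rfl fun v _ => ?_
    have : ∀ x : Fin n, drawProb w (Fin.snocEquiv (fun _ : Fin (k + 1) => Fin n) (x, v)) =
      drawProb w v * if x ∈ Finset.univ.image v then 0 else
        w x / ∑ u ∈ Finset.univ \ Finset.univ.image v, w u := fun x => drawProb_snoc w v x
    simp only [this]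
    rw [← Finset.mul_sum]
    have hne : (Finset.univ \ Finset.univ.image v).Nonempty := by
      rw [← Finset.card_pos]
      have h1 := Finset.le_card_sdiff (Finset.univ.image v) Finset.univ
      have h2 : (Finset.univ.image v).card ≤ k := by simpa using Finset.card_image_le (s := Finset.univ) (f := v)
      simp only [Finset.card_univ, Fintype.card_fin] at h1
      omega
    have hpos : 0 < ∑ u ∈ Finset.univ \ Finset.univ.image v, w u :=
      Finset.sum_pos (fun u _ => hw u) hne
    rw [Finset.sum_ite, Finset.sum_const_zero, zero_add, Finset.filter_notMem_eq_sdiff,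
      ← Finset.sum_div, div_self hpos.ne', mul_one]

theorem clauseProb_nonneg {n k : ℕ} {w : Fin n → ℝ} (hw : ∀ i, 0 < w i)
    (c : Fin k → Literal (Fin n)) : 0 ≤ clauseProb w c :=
  mul_nonneg (drawProb_nonneg hw _) (by positivity)

theorem sum_clauseProb {n k : ℕ} {w : Fin n → ℝ} (hw : ∀ i, 0 < w i) (hk : k ≤ n) :
    ∑ c : Fin k → Literal (Fin n), clauseProb w c = 1 := by
  rw [← (Equiv.arrowProdEquivProdArrow (Fin k) (fun _ => Fin n) (fun _ => Bool)).symm.sum_comp,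
    Fintype.sum_prod_type]
  have : ∀ (v : Fin k → Fin n) (b : Fin k → Bool),
    clauseProb w ((Equiv.arrowProdEquivProdArrow (Fin k) (fun _ => Fin n)
      (fun _ => Bool)).symm (v, b)) = drawProb w v * (1 / 2) ^ k := fun _ _ => rfl
  simp only [this]
  refine Eq.trans (Finset.sum_congr rfl fun v _ => ?_) (sum_drawProb hw k hk)
  simp only [Finset.sum_const, Finset.card_univ, Fintype.card_pi, Fintype.card_bool,
    Finset.prod_const, Fintype.card_fin, nsmul_eq_mul]
  push_cast
  rw [mul_left_comm, ← mul_pow]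
  norm_num

/-- The probability of a sequence of `m` drawn clauses. -/
noncomputable def formulaProb {n m k : ℕ} (w : Fin n → ℝ) (d : Fin m → Fin k → Literal (Fin n)) :
    ℝ := ∏ i, clauseProb w (d i)

theorem formulaProb_nonneg {n m k : ℕ} {w : Fin n → ℝ} (hw : ∀ i, 0 < w i)
    (d : Fin m → Fin k → Literal (Fin n)) : 0 ≤ formulaProb w d :=
  Finset.prod_nonneg fun _ _ => clauseProb_nonneg hw _

theorem sum_formulaProb {n m k : ℕ} {w : Fin n → ℝ} (hw : ∀ i, 0 < w i) (hk : k ≤ n) :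
    ∑ d : Fin m → Fin k → Literal (Fin n), formulaProb w d = 1 := by
  have := Finset.prod_univ_sum (fun _ : Fin m => (Finset.univ : Finset (Fin k → Literal (Fin n))))
    (fun _ c => clauseProb w c)
  simp only [sum_clauseProb hw hk, Finset.prod_const_one, Fintype.piFinset_univ] at this
  exact this.symm

theorem prob_mono {n m k : ℕ} {w : Fin n → ℝ} (hw : ∀ i, 0 < w i) {S T : Set (CNF n m)}
    (h : S ⊆ T) : prob k w S ≤ prob k w T :=
  Finset.sum_le_sum fun d _ => Set.indicator_le_indicator_of_subset
    (Set.preimage_mono h) (fun d => formulaProb_nonneg hw d) d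

theorem prob_nonneg {n m k : ℕ} {w : Fin n → ℝ} (hw : ∀ i, 0 < w i) (S : Set (CNF n m)) :
    0 ≤ prob k w S :=
  Finset.sum_nonneg fun d _ => Set.indicator_nonneg (fun d _ => formulaProb_nonneg hw d) d

theorem prob_inter_add_prob_diff {n m k : ℕ} (w : Fin n → ℝ) (S T : Set (CNF n m)) :
    prob k w (S ∩ T) + prob k w (S \ T) = prob k w S := by
  classical
  unfold prob
  rw [← Finset.sum_add_distrib]
  refine Finset.sum_congr rfl fun d _ => ?_
  simp only [Set.indicator_apply, Set.mem_preimage, Set.mem_inter_iff, Set.mem_sdiff]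
  by_cases h1 : toCNF d ∈ S <;> by_cases h2 : toCNF d ∈ T <;> simp [h1, h2]

theorem prob_univ {n m k : ℕ} {w : Fin n → ℝ} (hw : ∀ i, 0 < w i) (hk : k ≤ n) :
    prob k w (Set.univ : Set (CNF n m)) = 1 := by
  rw [← sum_formulaProb (m := m) hw hk]
  simp [prob, formulaProb]

theorem one_sub_prob_compl {n m k : ℕ} {w : Fin n → ℝ} (hw : ∀ i, 0 < w i) (hk : k ≤ n)
    (S : Set (CNF n m)) : prob k w S = 1 - prob k w Sᶜ := by
  have := prob_inter_add_prob_diff (k := k) w Set.univ S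
  rw [prob_univ hw hk, Set.univ_inter, ← Set.compl_eq_univ_sdiff] at this
  linarith

/-! ### Few distinct variables -/

/-- Exposes independent draws one at a time, with `S` the variables already seen. It serves twice:
for the literals of a clause and for the clauses of a formula. The `p i` need not have total mass 1,
and `N` limits the step bound to sets that can actually arise. -/
theorem sum_prod_mul_pow_card_le {X V : Type*} [Fintype X] [DecidableEq V] {τ : ℝ} {N : ℕ} {m : ℕ}
    (p : Fin m → X → ℝ) (vars : Fin m → X → Finset V) (B : Fin m → ℝ) (a : Fin m → ℕ)
    (hp : ∀ i x, 0 ≤ p i x) (hB : ∀ i, 0 ≤ B i) (ha : ∀ i x, (vars i x).card ≤ a i)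
    (hstep : ∀ i (S : Finset V), S.card + a i ≤ N →
      ∑ x, p i x * τ ^ (S ∪ vars i x).card ≤ B i * τ ^ S.card)
    (S : Finset V) (hS : S.card + ∑ i, a i ≤ N) :
    ∑ d : Fin m → X, (∏ i, p i (d i)) * τ ^ (S ∪ Finset.univ.biUnion fun i => vars i (d i)).card ≤
      (∏ i, B i) * τ ^ S.card := by
  induction m generalizing S with
  | zero => simp
  | succ m ih =>
    rw [← (Fin.consEquiv (fun _ : Fin (m + 1) => X)).sum_comp, Fintype.sum_prod_type]
    rw [Fin.sum_univ_succ] at hS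
    have hcons : ∀ (x : X) (d : Fin m → X),
        (∏ i, p i (Fin.consEquiv (fun _ : Fin (m + 1) => X) (x, d) i)) *
          τ ^ (S ∪ Finset.univ.biUnion fun i =>
            vars i (Fin.consEquiv (fun _ : Fin (m + 1) => X) (x, d) i)).card =
        p 0 x * ((∏ i : Fin m, p i.succ (d i)) *
          τ ^ ((S ∪ vars 0 x) ∪ Finset.univ.biUnion fun i : Fin m => vars i.succ (d i)).card) := by
      intro x d
      have hU : (S ∪ Finset.univ.biUnion fun i =>
            vars i (Fin.consEquiv (fun _ : Fin (m + 1) => X) (x, d) i)) =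
          (S ∪ vars 0 x) ∪ Finset.univ.biUnion fun i : Fin m => vars i.succ (d i) := by
        ext v
        simp [Fin.consEquiv, Fin.exists_fin_succ]
      rw [hU, Fin.prod_univ_succ, mul_assoc]
      simp [Fin.consEquiv]
    simp only [hcons]
    calc _ ≤ ∑ x, p 0 x * ((∏ i : Fin m, B i.succ) * τ ^ (S ∪ vars 0 x).card) := by
          refine Finset.sum_le_sum fun x _ => ?_
          rw [← Finset.mul_sum]
          refine mul_le_mul_of_nonneg_left ?_ (hp 0 x)
          refine ih (fun i => p i.succ) (fun i => vars i.succ) (fun i => B i.succ)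
            (fun i => a i.succ) (fun i => hp i.succ) (fun i => hB i.succ) (fun i => ha i.succ)
            (fun i => hstep i.succ) _ ?_
          have := Finset.card_union_le S (vars 0 x)
          have := ha 0 x
          omega
      _ = (∏ i : Fin m, B i.succ) * ∑ x, p 0 x * τ ^ (S ∪ vars 0 x).card := by
          rw [Finset.mul_sum]
          exact Finset.sum_congr rfl fun x _ => by ring
      _ ≤ (∏ i : Fin m, B i.succ) * (B 0 * τ ^ S.card) :=
          mul_le_mul_of_nonneg_left (hstep 0 S (by omega)) (Finset.prod_nonneg fun i _ => hB _)
      _ = _ := by rw [Fin.prod_univ_succ]; ring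

/-- The 3 is 1 + 2: repeated variables have mass at most τ, while new ones have mass at most 2 and
each contributes an extra factor τ. -/
theorem sum_literal_mul_pow_card_le {n N : ℕ} {τ : ℝ} (hτ : 0 ≤ τ) {q : Fin n → ℝ}
    (hq : ∀ u, 0 ≤ q u) (hq2 : ∑ u, q u ≤ 2)
    (hqτ : ∀ S : Finset (Fin n), S.card ≤ N → ∑ u ∈ S, q u ≤ τ)
    (S : Finset (Fin n)) (hS : S.card ≤ N) :
    ∑ l : Literal (Fin n), q l.1 / 2 * τ ^ (S ∪ {l.1}).card ≤ 3 * τ * τ ^ S.card := by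
  rw [Fintype.sum_prod_type]
  have h1 : ∀ u : Fin n, ∑ b : Bool, q (u, b).1 / 2 * τ ^ (S ∪ {(u, b).1}).card =
      q u * τ ^ (S ∪ {u}).card := by
    intro u
    simp only [Fintype.sum_bool]
    ring
  simp only [h1]
  rw [← Finset.sum_add_sum_compl S]
  have h2 : ∑ u ∈ S, q u * τ ^ (S ∪ {u}).card ≤ τ * τ ^ S.card := by
    have : ∀ u ∈ S, q u * τ ^ (S ∪ {u}).card = q u * τ ^ S.card := fun u hu => by
      rw [Finset.union_eq_left.2 (by simpa using hu)]
    rw [Finset.sum_congr rfl this, ← Finset.sum_mul]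
    exact mul_le_mul_of_nonneg_right (hqτ S hS) (by positivity)
  have h3 : ∑ u ∈ Sᶜ, q u * τ ^ (S ∪ {u}).card ≤ 2 * (τ * τ ^ S.card) := by
    have : ∀ u ∈ Sᶜ, q u * τ ^ (S ∪ {u}).card = q u * (τ * τ ^ S.card) := fun u hu => by
      rw [Finset.card_union_of_disjoint (by simpa using hu), Finset.card_singleton, pow_succ']
    rw [Finset.sum_congr rfl this, ← Finset.sum_mul]
    refine mul_le_mul_of_nonneg_right (le_trans ?_ hq2) (by positivity)
    exact Finset.sum_le_sum_of_subset_of_nonneg (Finset.subset_univ _) fun u _ _ => hq u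
  linarith

theorem sum_formulaProb_mul_pow_card_le {n m k : ℕ} {τ : ℝ} (hτ : 0 ≤ τ) {w q : Fin n → ℝ}
    (hw : ∀ i, 0 < w i) (hk : k ≤ n) (hq : ∀ u, 0 ≤ q u) (hq2 : ∑ u, q u ≤ 2)
    (hdraw : ∀ v : Fin k → Fin n, drawProb w v ≤ ∏ j, q (v j)) (R : Finset (Fin m))
    (hqτ : ∀ S : Finset (Fin n), S.card ≤ k * R.card → ∑ u ∈ S, q u ≤ τ) :
    ∑ d : Fin m → Fin k → Literal (Fin n),
      formulaProb w d * τ ^ (varsOf (toCNF d) R).card ≤ (3 * τ) ^ (k * R.card) := by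
  have hcl : ∀ S : Finset (Fin n), S.card + k ≤ k * R.card →
      ∑ c : Fin k → Literal (Fin n),
        clauseProb w c * τ ^ (S ∪ Finset.univ.image fun j => (c j).1).card ≤
      (3 * τ) ^ k * τ ^ S.card := by
    intro S hS
    have := sum_prod_mul_pow_card_le (τ := τ) (N := k * R.card)
      (fun (_ : Fin k) (l : Literal (Fin n)) => q l.1 / 2) (fun _ l => {l.1}) (fun _ => 3 * τ)
      (fun _ => 1) (fun _ l => by have := hq l.1; positivity) (fun _ => by positivity)
      (fun _ _ => by simp)
      (fun _ S hS => sum_literal_mul_pow_card_le hτ hq hq2 hqτ S (by omega)) S (by simpa using hS)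
    simp only [Finset.prod_const, Finset.card_univ, Fintype.card_fin] at this
    refine le_trans (Finset.sum_le_sum fun c _ => ?_) this
    rw [Finset.biUnion_singleton]
    refine mul_le_mul_of_nonneg_right ?_ (by positivity)
    rw [Finset.prod_div_distrib, Finset.prod_const, Finset.card_univ, Fintype.card_fin,
      clauseProb, one_div, inv_pow, ← div_eq_mul_inv]
    exact div_le_div_of_nonneg_right (hdraw _) (by positivity)
  have := sum_prod_mul_pow_card_le (τ := τ) (N := k * R.card)
    (fun (_ : Fin m) (c : Fin k → Literal (Fin n)) => clauseProb w c)
    (fun i c => if i ∈ R then Finset.univ.image fun j => (c j).1 else ∅)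
    (fun i => if i ∈ R then (3 * τ) ^ k else 1)
    (fun i => if i ∈ R then k else 0) (fun _ c => clauseProb_nonneg hw c)
    (fun i => by split_ifs <;> positivity)
    (fun i c => by
      split_ifs
      · simpa using Finset.card_image_le (s := Finset.univ) (f := fun j => (c j).1)
      · simp)
    (fun i S hS => by
      split_ifs with hi
      · simp only [hi, if_true] at hS
        exact hcl S hS
      · simp only [Finset.union_empty]
        rw [← Finset.sum_mul, sum_clauseProb hw hk]) ∅ (by
      rw [Finset.sum_ite_mem]
      simp [mul_comm])
  rw [Finset.prod_ite_mem] at this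
  simp only [Finset.univ_inter, Finset.prod_const, ← pow_mul, Finset.card_empty, pow_zero, mul_one,
    Finset.empty_union] at this
  refine le_trans (le_of_eq (Finset.sum_congr rfl fun d _ => ?_)) this
  have : varsOf (toCNF d) R =
      Finset.univ.biUnion fun i => if i ∈ R then Finset.univ.image fun j => (d i j).1 else ∅ := by
    ext v
    simp only [varsOf, toCNF, Finset.mem_biUnion, Finset.mem_image, Finset.mem_univ, true_and]
    constructor
    · rintro ⟨i, hi, l, ⟨j, rfl⟩, rfl⟩
      exact ⟨i, by simp [hi]⟩
    · rintro ⟨i, hi⟩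
      split_ifs at hi with hiR
      · simp only [Finset.mem_image, Finset.mem_univ, true_and] at hi
        obtain ⟨j, rfl⟩ := hi
        exact ⟨i, hiR, d i j, ⟨j, rfl⟩, rfl⟩
      · simp at hi
  rw [this, formulaProb]

/-- The probability that the clauses in `R` contain fewer than `x` variables. -/
theorem prob_card_varsOf_lt_le {n m k : ℕ} {τ : ℝ} (hτ : 0 < τ) (hτ1 : τ ≤ 1) {w q : Fin n → ℝ}
    (hw : ∀ i, 0 < w i) (hk : k ≤ n) (hq : ∀ u, 0 ≤ q u) (hq2 : ∑ u, q u ≤ 2)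
    (hdraw : ∀ v : Fin k → Fin n, drawProb w v ≤ ∏ j, q (v j)) (R : Finset (Fin m))
    (hqτ : ∀ S : Finset (Fin n), S.card ≤ k * R.card → ∑ u ∈ S, q u ≤ τ) (x : ℝ) :
    prob k w {Φ : CNF n m | ((varsOf Φ R).card : ℝ) < x} ≤ (3 * τ) ^ (k * R.card) / τ ^ x := by
  classical
  -- Markov's inequality for `τ ^ (varsOf Φ R).card`, which is large when there are few variables
  -- since τ ≤ 1.
  rw [le_div_iff₀ (by positivity)]
  refine le_trans ?_ (sum_formulaProb_mul_pow_card_le hτ.le hw hk hq hq2 hdraw R hqτ)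
  rw [prob, Finset.sum_mul]
  refine Finset.sum_le_sum fun d _ => ?_
  rw [Set.indicator_apply]
  split_ifs with h
  · refine mul_le_mul_of_nonneg_left ?_ (formulaProb_nonneg hw d)
    rw [← Real.rpow_natCast]
    exact Real.rpow_le_rpow_of_exponent_ge hτ hτ1 (le_of_lt h)
  · rw [zero_mul]
    exact mul_nonneg (formulaProb_nonneg hw d) (by positivity)

/-- Union bound for expansion. -/
theorem prob_not_isExpander_le {n m k r : ℕ} {δ : ℝ} {w : Fin n → ℝ} (hw : ∀ i, 0 < w i)
    (b : ℕ → ℝ)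
    (h : ∀ R : Finset (Fin m), R.Nonempty → R.card ≤ r →
      prob k w {Φ : CNF n m | ((varsOf Φ R).card : ℝ) < (1 + δ) * R.card} ≤ b R.card) :
    prob k w {Φ : CNF n m | ¬ IsExpander Φ r δ} ≤
      ∑ s ∈ Finset.Icc 1 (min r m), (m.choose s : ℝ) * b s := by
  classical
  let 𝓡 : Finset (Finset (Fin m)) := Finset.univ.filter fun R => R.Nonempty ∧ R.card ≤ r
  calc prob k w {Φ : CNF n m | ¬ IsExpander Φ r δ}
      ≤ ∑ R ∈ 𝓡, prob k w {Φ : CNF n m | ((varsOf Φ R).card : ℝ) < (1 + δ) * R.card} := by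
        unfold prob
        rw [Finset.sum_comm]
        refine Finset.sum_le_sum fun d _ => ?_
        have hnn : ∀ R ∈ 𝓡, 0 ≤ (toCNF ⁻¹' {Φ : CNF n m |
            ((varsOf Φ R).card : ℝ) < (1 + δ) * R.card}).indicator
            (fun d => ∏ i : Fin m, clauseProb w (d i)) d := fun R _ =>
          Set.indicator_nonneg (fun d _ => formulaProb_nonneg hw d) d
        rw [Set.indicator_apply]
        split_ifs with hd
        · simp only [Set.mem_preimage, Set.mem_ofPred_eq, IsExpander, not_forall, not_le] at hd
          obtain ⟨R, hR, hlt⟩ := hd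
          have hRm : R ∈ 𝓡 := by
            refine Finset.mem_filter.2 ⟨Finset.mem_univ _, ?_, hR⟩
            rw [Finset.nonempty_iff_ne_empty]
            rintro rfl
            simp [varsOf] at hlt
          refine le_trans ?_ (Finset.single_le_sum hnn hRm)
          rw [Set.indicator_of_mem (by simpa using hlt)]
        · exact Finset.sum_nonneg hnn
    _ ≤ ∑ R ∈ 𝓡, b R.card := by
        refine Finset.sum_le_sum fun R hR => ?_
        have := (Finset.mem_filter.1 hR).2
        exact h R this.1 this.2
    _ = ∑ R : Finset (Fin m), if 1 ≤ R.card ∧ R.card ≤ r then b R.card else 0 := by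
        rw [Finset.sum_filter]
        refine Finset.sum_congr rfl fun R _ => ?_
        simp only [Finset.one_le_card]
    _ = ∑ s ∈ Finset.range (m + 1), (m.choose s : ℝ) * if 1 ≤ s ∧ s ≤ r then b s else 0 := by
        rw [← Finset.powerset_univ,
          Finset.sum_powerset_apply_card fun s => if 1 ≤ s ∧ s ≤ r then b s else 0]
        simp
    _ = _ := by
        simp only [mul_ite, mul_zero]
        rw [← Finset.sum_filter]
        refine Finset.sum_congr ?_ fun _ _ => rfl
        ext s
        simp only [Finset.mem_filter, Finset.mem_range, Finset.mem_Icc]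
        omega

/-! ### Power-law weights -/

theorem sum_range_add_one_rpow_neg_le {α : ℝ} (hα0 : 0 < α) (hα1 : α < 1) (N : ℕ) :
    ∑ i ∈ Finset.range N, ((i : ℝ) + 1) ^ (-α) ≤ (N : ℝ) ^ (1 - α) / (1 - α) := by
  have h1α : 0 < 1 - α := by linarith
  induction N with
  | zero => simp [Real.zero_rpow h1α.ne']
  | succ N ih =>
    rw [Finset.sum_range_succ]
    have hN : (0 : ℝ) < (N : ℝ) + 1 := by positivity
    -- Bernoulli's inequality replaces the comparison with an integral.
    have hb := rpow_one_add_le_one_add_mul_self (s := -((N : ℝ) + 1)⁻¹) (p := 1 - α)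
      (by rw [neg_le_neg_iff]; exact inv_le_one_of_one_le₀ (by linarith [(Nat.cast_nonneg N : (0:ℝ) ≤ N)]))
      h1α.le (by linarith)
    have hmul : (N : ℝ) = ((N : ℝ) + 1) * (1 + -((N : ℝ) + 1)⁻¹) := by
      field_simp
      ring
    have hnn : (0 : ℝ) ≤ 1 + -((N : ℝ) + 1)⁻¹ := by
      have : ((N : ℝ) + 1)⁻¹ ≤ 1 := inv_le_one_of_one_le₀ (by linarith [(Nat.cast_nonneg N : (0:ℝ) ≤ N)])
      linarith
    have hpow : (N : ℝ) ^ (1 - α) ≤ ((N : ℝ) + 1) ^ (1 - α) - (1 - α) * ((N : ℝ) + 1) ^ (-α) := by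
      rw [show (N : ℝ) ^ (1 - α) = (((N : ℝ) + 1) * (1 + -((N : ℝ) + 1)⁻¹)) ^ (1 - α) by rw [← hmul],
        Real.mul_rpow hN.le hnn]
      refine (mul_le_mul_of_nonneg_left hb (by positivity)).trans (le_of_eq ?_)
      rw [show (1 : ℝ) - α = -α + 1 by ring, Real.rpow_add_one hN.ne']
      field_simp
      ring
    push_cast
    have : (N : ℝ) ^ (1 - α) / (1 - α) + ((N : ℝ) + 1) ^ (-α) ≤
        ((N : ℝ) + 1) ^ (1 - α) / (1 - α) := by
      rw [le_div_iff₀ h1α, add_mul, div_mul_cancel₀ _ h1α.ne']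
      linarith
    linarith

theorem powerLawWeight_eq (β : ℝ) (n : ℕ) (i : Fin n) :
    powerLawWeight β n i = ((i : ℝ) + 1) ^ (-(1 / (β - 1))) := by
  rw [powerLawWeight, neg_div]

theorem powerLawWeight_pos (β : ℝ) (n : ℕ) (i : Fin n) : 0 < powerLawWeight β n i :=
  Real.rpow_pos_of_pos (by positivity) _

theorem powerLawWeight_le_one {β : ℝ} (hα : 0 < 1 / (β - 1)) (n : ℕ) (i : Fin n) :
    powerLawWeight β n i ≤ 1 := by
  rw [powerLawWeight_eq]
  exact Real.rpow_le_one_of_one_le_of_nonpos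
    (by linarith [(Nat.cast_nonneg (i : ℕ) : (0 : ℝ) ≤ (i : ℕ))]) (by linarith)

theorem rpow_le_sum_powerLawWeight {β : ℝ} (hα : 0 < 1 / (β - 1)) {n : ℕ} (hn : 0 < n) :
    (n : ℝ) ^ (1 - 1 / (β - 1)) ≤ ∑ i, powerLawWeight β n i := by
  have hn' : (0 : ℝ) < n := by exact_mod_cast hn
  calc (n : ℝ) ^ (1 - 1 / (β - 1)) = ∑ _i : Fin n, (n : ℝ) ^ (-(1 / (β - 1))) := by
        rw [Finset.sum_const, Finset.card_univ, Fintype.card_fin, nsmul_eq_mul, sub_eq_add_neg,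
          Real.rpow_add hn', Real.rpow_one]
    _ ≤ _ := by
        refine Finset.sum_le_sum fun i _ => ?_
        rw [powerLawWeight_eq]
        refine Real.rpow_le_rpow_of_nonpos (by positivity) ?_ (by linarith)
        exact_mod_cast i.2

/-- Indices below `N` contribute at most the sum of the `N` heaviest weights; each of the at most
`N` others weighs at most N^(-α). No rearrangement is needed. -/
theorem sum_powerLawWeight_le {β : ℝ} (hα0 : 0 < 1 / (β - 1)) (hα1 : 1 / (β - 1) < 1) {n N : ℕ}
    (hN : 0 < N) (S : Finset (Fin n)) (hS : S.card ≤ N) :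
    ∑ u ∈ S, powerLawWeight β n u ≤
      (1 + 1 / (1 - 1 / (β - 1))) * (N : ℝ) ^ (1 - 1 / (β - 1)) := by
  have hN' : (0 : ℝ) < N := by exact_mod_cast hN
  set α := 1 / (β - 1) with hα
  rw [← Finset.sum_filter_add_sum_filter_not S (fun u : Fin n => (u : ℕ) < N)]
  have h1 : ∑ u ∈ S.filter (fun u : Fin n => (u : ℕ) < N), powerLawWeight β n u ≤ (N : ℝ) ^ (1 - α) / (1 - α) := by
    refine le_trans ?_ (sum_range_add_one_rpow_neg_le hα0 hα1 N)
    have : ∑ u ∈ S.filter (fun u : Fin n => (u : ℕ) < N), powerLawWeight β n u =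
        ∑ i ∈ (S.filter fun u : Fin n => (u : ℕ) < N).image (fun u : Fin n => (u : ℕ)), ((i : ℝ) + 1) ^ (-α) := by
      rw [Finset.sum_image fun u _ v _ h => Fin.ext h]
      exact Finset.sum_congr rfl fun u _ => powerLawWeight_eq β n u
    rw [this]
    refine Finset.sum_le_sum_of_subset_of_nonneg ?_ fun i _ _ => by positivity
    intro i hi
    simp only [Finset.mem_image, Finset.mem_filter] at hi
    obtain ⟨u, hu, rfl⟩ := hi
    exact Finset.mem_range.2 hu.2
  have h2 : ∑ u ∈ S.filter (fun u : Fin n => ¬ (u : ℕ) < N), powerLawWeight β n u ≤ (N : ℝ) ^ (1 - α) := by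
    have hle : ∀ u ∈ S.filter (fun u : Fin n => ¬ (u : ℕ) < N),
        powerLawWeight β n u ≤ (N : ℝ) ^ (-α) := by
      intro u hu
      rw [powerLawWeight_eq]
      refine Real.rpow_le_rpow_of_nonpos hN' ?_ (by linarith)
      have := not_lt.1 (Finset.mem_filter.1 hu).2
      have : (N : ℝ) ≤ (u : ℕ) := by exact_mod_cast this
      linarith
    refine (Finset.sum_le_card_nsmul _ _ _ hle).trans ?_
    rw [nsmul_eq_mul, sub_eq_add_neg, Real.rpow_add hN', Real.rpow_one]
    refine mul_le_mul_of_nonneg_right ?_ (by positivity)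
    exact_mod_cast (Finset.card_filter_le _ _).trans hS
  calc _ ≤ (N : ℝ) ^ (1 - α) / (1 - α) + (N : ℝ) ^ (1 - α) := add_le_add h1 h2
    _ = _ := by ring

/-- The variables already drawn weigh at most `k`, at most half the total, so each normalising sum
is at least half the total. -/
theorem drawProb_le_prod {n k : ℕ} {w : Fin n → ℝ} (hw : ∀ i, 0 < w i) (hw1 : ∀ i, w i ≤ 1)
    (hk : 0 < k) (hW : 2 * (k : ℝ) ≤ ∑ i, w i) (v : Fin k → Fin n) :
    drawProb w v ≤ ∏ j, (2 * w (v j) / ∑ i, w i) := by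
  have hk' : (0 : ℝ) < k := by exact_mod_cast hk
  refine Finset.prod_le_prod (fun j _ => ?_) fun j _ => ?_
  · split_ifs
    · rfl
    · exact div_nonneg (hw _).le (Finset.sum_nonneg fun u _ => (hw u).le)
  · have hpos : 0 < ∑ i, w i := by linarith
    split_ifs
    · exact div_nonneg (by linarith [hw (v j)]) hpos.le
    · have h1 : ∑ u ∈ drawnBefore v j, w u ≤ k := by
        refine (Finset.sum_le_card_nsmul _ _ 1 fun u _ => hw1 u).trans ?_
        rw [nsmul_eq_mul, mul_one]
        have := (Finset.card_image_le (s := Finset.univ.filter fun i : Fin k => i < j)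
          (f := v)).trans (Finset.card_le_univ _)
        rw [Fintype.card_fin] at this
        exact_mod_cast this
      have h2 : ∑ u ∈ Finset.univ \ drawnBefore v j, w u + ∑ u ∈ drawnBefore v j, w u =
          ∑ i, w i := Finset.sum_sdiff (Finset.subset_univ _)
      rw [div_le_div_iff₀ (by linarith) hpos]
      nlinarith [hw (v j)]

/-! ### Expansion of power-law formulas -/

theorem choose_le_exp_mul_div_pow (m : ℕ) {s : ℕ} (hs : 0 < s) :
    (m.choose s : ℝ) ≤ (Real.exp 1 * m / s) ^ s := by
  have hs' : (0 : ℝ) < s := by exact_mod_cast hs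
  have h1 := Real.pow_div_factorial_le_exp _ hs'.le s
  have hf : (0 : ℝ) < s.factorial := by exact_mod_cast s.factorial_pos
  refine (Nat.choose_le_pow_div s m).trans ?_
  have hexp : Real.exp s = Real.exp 1 ^ s := by rw [← Real.exp_nat_mul, mul_one]
  rw [hexp, div_le_iff₀ hf] at h1
  rw [div_pow, mul_pow, div_le_div_iff₀ hf (by positivity)]
  nlinarith [pow_nonneg (Nat.cast_nonneg m : (0 : ℝ) ≤ m) s]

/-- The summand of the union bound. -/
theorem choose_mul_le {k s m n : ℕ} {α ε δ a D₀ x τ : ℝ} (hs : 0 < s) (hn : 0 < n)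
    (hx : x = s / n) (hxa : x ≤ a) (ha1 : a ≤ 1) (hδ : 0 < δ) (hD₀ : 0 < D₀)
    (hexp : δ ≤ (1 - α) * (k - (1 + δ)) - 1 - ε)
    (hD : (m : ℝ) / n ≤ a ^ (1 + ε) * x ^ (-ε)) (hτ : τ = D₀ * x ^ (1 - α))
    (hK : Real.exp 1 * 3 ^ k * D₀ ^ ((k : ℝ) - (1 + δ)) * a ^ (1 + ε) ≤ 1 / 2) :
    (m.choose s : ℝ) * ((3 * τ) ^ (k * s) / τ ^ ((1 + δ) * s)) ≤ (1 / 2) ^ s * x ^ δ := by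
  have hs' : (0 : ℝ) < s := by exact_mod_cast hs
  have hn' : (0 : ℝ) < n := by exact_mod_cast hn
  have hx0 : 0 < x := by rw [hx]; positivity
  have hx1 : x ≤ 1 := hxa.trans ha1
  have hτ0 : 0 < τ := by rw [hτ]; positivity
  have hbase : (3 * τ) ^ (k * s) / τ ^ ((1 + δ) * s) =
      (3 ^ k * (D₀ ^ ((k : ℝ) - (1 + δ)) * x ^ ((1 - α) * (k - (1 + δ))))) ^ s := by
    rw [Real.rpow_mul_natCast hτ0.le, pow_mul, ← div_pow]
    congr 1
    rw [mul_pow, mul_div_assoc, ← Real.rpow_natCast τ k, ← Real.rpow_sub hτ0]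
    rw [Real.rpow_mul hx0.le, ← Real.mul_rpow hD₀.le (by positivity), ← hτ]
  have hm : Real.exp 1 * m / s = Real.exp 1 * (m / n) * x⁻¹ := by
    rw [hx]; field_simp
  calc (m.choose s : ℝ) * ((3 * τ) ^ (k * s) / τ ^ ((1 + δ) * s))
      ≤ (Real.exp 1 * (m / n) * x⁻¹) ^ s *
        (3 ^ k * (D₀ ^ ((k : ℝ) - (1 + δ)) * x ^ ((1 - α) * (k - (1 + δ))))) ^ s := by
        rw [hbase, ← hm]
        exact mul_le_mul_of_nonneg_right (choose_le_exp_mul_div_pow m hs) (by positivity)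
    _ ≤ (1 / 2 * x ^ δ) ^ s := by
        rw [← mul_pow]
        refine pow_le_pow_left₀ (by positivity) ?_ s
        calc _ ≤ Real.exp 1 * (a ^ (1 + ε) * x ^ (-ε)) * x⁻¹ *
              (3 ^ k * (D₀ ^ ((k : ℝ) - (1 + δ)) * x ^ ((1 - α) * (k - (1 + δ))))) := by
              gcongr
          _ = (Real.exp 1 * 3 ^ k * D₀ ^ ((k : ℝ) - (1 + δ)) * a ^ (1 + ε)) *
              x ^ ((1 - α) * (k - (1 + δ)) - 1 - ε) := by
              rw [Real.rpow_sub hx0, Real.rpow_sub hx0, Real.rpow_one, Real.rpow_neg hx0.le]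
              field_simp
          _ ≤ 1 / 2 * x ^ δ := by
              refine mul_le_mul hK ?_ (by positivity) (by norm_num)
              exact Real.rpow_le_rpow_of_exponent_ge hx0 hx1 hexp
    -- As s ≥ 1, one factor x^δ may be kept and the others dropped; it supplies the decay in `n`.
    _ ≤ (1 / 2) ^ s * x ^ δ := by
        rw [mul_pow]
        refine mul_le_mul_of_nonneg_left ?_ (by positivity)
        exact pow_le_of_le_one (by positivity) (Real.rpow_le_one hx0.le hx1 hδ.le) hs.ne'

theorem sum_half_pow_mul_rpow_le {δ : ℝ} (hδ : δ ≤ 1) {n : ℕ} (hn : 0 < n) (M : ℕ) :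
    ∑ s ∈ Finset.Icc 1 M, (1 / 2 : ℝ) ^ s * ((s : ℝ) / n) ^ δ ≤ 2 * (n : ℝ) ^ (-δ) := by
  have hn' : (0 : ℝ) < n := by exact_mod_cast hn
  have hsum : ∑ s ∈ Finset.Icc 1 M, (s : ℝ) * (1 / 2 : ℝ) ^ s ≤ 2 := by
    have hr : ‖(1 / 2 : ℝ)‖ < 1 := by norm_num
    have h1 : Summable fun s : ℕ => (s : ℝ) * (1 / 2 : ℝ) ^ s := by
      simpa using summable_pow_mul_geometric_of_norm_lt_one 1 hr
    refine (h1.sum_le_tsum _ fun s _ => by positivity).trans (le_of_eq ?_)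
    rw [tsum_coe_mul_geometric_of_norm_lt_one hr]
    norm_num
  calc _ ≤ ∑ s ∈ Finset.Icc 1 M, ((s : ℝ) * (1 / 2 : ℝ) ^ s) * (n : ℝ) ^ (-δ) := by
        refine Finset.sum_le_sum fun s hs => ?_
        have hs1 : (1 : ℝ) ≤ s := by exact_mod_cast (Finset.mem_Icc.1 hs).1
        rw [Real.div_rpow (by positivity) hn'.le, Real.rpow_neg hn'.le, mul_comm (s : ℝ), mul_assoc,
          div_eq_mul_inv ((s : ℝ) ^ δ)]
        gcongr
        simpa using Real.rpow_le_rpow_of_exponent_le hs1 hδ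
    _ = (∑ s ∈ Finset.Icc 1 M, (s : ℝ) * (1 / 2 : ℝ) ^ s) * (n : ℝ) ^ (-δ) := by
        rw [Finset.sum_mul]
    _ ≤ _ := mul_le_mul_of_nonneg_right hsum (by positivity)

/-- Two scales of set sizes `x n`: at most the number `D n` of clauses, and at most
`a ^ (1 + 1 / ε) * D ^ (-1 / ε) * n`. -/
theorem le_and_le_of_le_mul_rpow {ε a D x : ℝ} (hε : 0 < ε) (ha : 0 < a) (hD : 0 < D) (hx : 0 < x)
    (hxD : x ≤ D) (h : x ≤ a ^ (1 + 1 / ε) * D ^ (-1 / ε)) :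
    x ≤ a ∧ D ≤ a ^ (1 + ε) * x ^ (-ε) := by
  constructor
  -- At low density the number of clauses already gives x ≤ a, so `a` need not depend on the
  -- constant in m = Ω(n).
  · rcases le_total D a with hDa | hDa
    · exact hxD.trans hDa
    · calc x ≤ a ^ (1 + 1 / ε) * D ^ (-1 / ε) := h
        _ ≤ a ^ (1 + 1 / ε) * a ^ (-1 / ε) := by
            refine mul_le_mul_of_nonneg_left ?_ (by positivity)
            exact Real.rpow_le_rpow_of_nonpos ha hDa
              (div_nonpos_of_nonpos_of_nonneg (by norm_num) hε.le)
        _ = a := by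
            rw [← Real.rpow_add ha]
            ring_nf
            simp
  · have h1 := Real.rpow_le_rpow hx.le h hε.le
    rw [Real.mul_rpow (by positivity) (by positivity), ← Real.rpow_mul ha.le, ← Real.rpow_mul hD.le,
      div_mul_cancel₀ _ hε.ne', Real.rpow_neg_one, show (1 + 1 / ε) * ε = 1 + ε by field_simp; ring,
      ← div_eq_mul_inv, le_div_iff₀ hD] at h1
    rw [Real.rpow_neg hx.le, ← div_eq_mul_inv, le_div_iff₀ (by positivity)]
    linarith

theorem prob_not_isExpander_powerLaw_le {k n m : ℕ} {β ε δ a D₀ : ℝ} (hk : 0 < k)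
    (hα0 : 0 < 1 / (β - 1)) (hα1 : 1 / (β - 1) < 1) (hε : 0 < ε) (hδ : 0 < δ) (hδ1 : δ ≤ 1)
    (ha : 0 < a) (ha1 : a ≤ 1)
    (hexp : δ ≤ (1 - 1 / (β - 1)) * (k - (1 + δ)) - 1 - ε)
    (hD₀ : D₀ = 2 * (1 + 1 / (1 - 1 / (β - 1))) * (k : ℝ) ^ (1 - 1 / (β - 1)))
    (hτ1 : D₀ * a ^ (1 - 1 / (β - 1)) ≤ 1)
    (hK : Real.exp 1 * 3 ^ k * D₀ ^ ((k : ℝ) - (1 + δ)) * a ^ (1 + ε) ≤ 1 / 2)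
    (hkn : k ≤ n) (hnk : 2 * (k : ℝ) ≤ (n : ℝ) ^ (1 - 1 / (β - 1))) (hm : 0 < m) :
    prob k (powerLawWeight β n) {Φ : CNF n m | ¬ IsExpander Φ
      ⌊a ^ (1 + 1 / ε) * (n * ((m : ℝ) / n) ^ (-1 / ε))⌋₊ δ} ≤ 2 * (n : ℝ) ^ (-δ) := by
  have hn : 0 < n := hk.trans_le hkn
  have hk' : (0 : ℝ) < k := by exact_mod_cast hk
  have hn' : (0 : ℝ) < n := by exact_mod_cast hn
  have hm' : (0 : ℝ) < m := by exact_mod_cast hm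
  set α := 1 / (β - 1) with hα
  set r := ⌊a ^ (1 + 1 / ε) * (n * ((m : ℝ) / n) ^ (-1 / ε))⌋₊ with hr
  have h1α : 0 < 1 - α := by linarith
  have hD₀pos : 0 < D₀ := by rw [hD₀]; positivity
  have hw := powerLawWeight_pos β n
  have hWn := rpow_le_sum_powerLawWeight hα0 hn
  set W := ∑ i, powerLawWeight β n i with hW
  have hWpos : 0 < W := by linarith
  have hxs : ∀ s : ℕ, 0 < s → s ≤ r → s ≤ m →
      (s : ℝ) / n ≤ a ∧ (m : ℝ) / n ≤ a ^ (1 + ε) * ((s : ℝ) / n) ^ (-ε) := by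
    intro s hs hsr hsm
    have hs' : (0 : ℝ) < s := by exact_mod_cast hs
    refine le_and_le_of_le_mul_rpow hε ha (by positivity) (by positivity) ?_ ?_
    · gcongr
    · rw [div_le_iff₀ hn']
      have h1 : (s : ℝ) ≤ r := by exact_mod_cast hsr
      refine (h1.trans (Nat.floor_le (by positivity))).trans (le_of_eq (by ring))
  refine (prob_not_isExpander_le hw (fun s => (3 * (D₀ * ((s : ℝ) / n) ^ (1 - α))) ^ (k * s) /
    (D₀ * ((s : ℝ) / n) ^ (1 - α)) ^ ((1 + δ) * s)) ?_).trans ?_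
  · intro R hRne hRr
    have hR0 : 0 < R.card := Finset.card_pos.2 hRne
    have hRm : R.card ≤ m := by simpa using Finset.card_le_univ R
    have hs' : (0 : ℝ) < R.card := by exact_mod_cast hR0
    have hxa := (hxs R.card hR0 hRr hRm).1
    refine prob_card_varsOf_lt_le (q := fun u => 2 * powerLawWeight β n u / W) (by positivity) ?_ hw
      hkn (fun u => div_nonneg (by linarith [hw u]) hWpos.le) ?_
      (drawProb_le_prod hw (powerLawWeight_le_one hα0 n) hk (hnk.trans hWn)) R ?_ _
    · refine le_trans ?_ hτ1
      gcongr
    · rw [← Finset.sum_div, ← Finset.mul_sum, mul_div_assoc, div_self hWpos.ne', mul_one]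
    · intro S hS
      have h1 := sum_powerLawWeight_le hα0 hα1 (Nat.mul_pos hk hR0) S hS
      rw [← Finset.sum_div, ← Finset.mul_sum]
      calc _ ≤ 2 * ((1 + 1 / (1 - α)) * ((k * R.card : ℕ) : ℝ) ^ (1 - α)) / (n : ℝ) ^ (1 - α) := by
            gcongr
        _ = _ := by
            push_cast
            rw [hD₀, Real.mul_rpow hk'.le hs'.le, Real.div_rpow hs'.le hn'.le]
            ring
  · refine le_trans (Finset.sum_le_sum fun s hs => ?_) (sum_half_pow_mul_rpow_le hδ1 hn (min r m))
    rw [Finset.mem_Icc] at hs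
    obtain ⟨h1, h2⟩ := hxs s (by omega) (by omega) (by omega)
    exact choose_mul_le (by omega) hn rfl h1 ha1 hδ hD₀pos hexp h2 rfl hK

/-! ### The asymptotic lower bound -/

theorem exists_union_bound_constants {k : ℕ} {α ε D₀ : ℝ} (hα0 : 0 < α) (hα1 : α < 1)
    (hε : 0 < ε) (hgap : ε < ((k : ℝ) - 1) * (1 - α) - 1) :
    ∃ δ a : ℝ, 0 < δ ∧ δ ≤ 1 ∧ 0 < a ∧ a ≤ 1 ∧ δ ≤ (1 - α) * (k - (1 + δ)) - 1 - ε ∧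
      D₀ * a ^ (1 - α) ≤ 1 ∧
      Real.exp 1 * 3 ^ k * D₀ ^ ((k : ℝ) - (1 + δ)) * a ^ (1 + ε) ≤ 1 / 2 := by
  set g := ((k : ℝ) - 1) * (1 - α) - 1 - ε with hg
  have hg0 : 0 < g := by linarith
  -- The exponent condition reads (2 - α)δ ≤ g, so δ ≤ g/2 suffices; δ ≤ 1 is for summing the union
  -- bound.
  have hδ0 : 0 < min 1 g / 2 := by positivity
  have hδ1 : min 1 g / 2 ≤ 1 := by linarith [min_le_left 1 g]
  have hδg : min 1 g / 2 ≤ g / 2 := by linarith [min_le_right 1 g]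
  set δ := min 1 g / 2
  have hlim : ∀ c p : ℝ, 0 < p → Tendsto (fun a : ℝ => c * a ^ p) (𝓝[>] 0) (𝓝 0) := by
    intro c p hp
    have h := ((Real.continuousAt_rpow_const 0 p (Or.inr hp.le)).tendsto.mono_left
      (nhdsWithin_le_nhds (s := Set.Ioi 0))).const_mul c
    rwa [Real.zero_rpow hp.ne', mul_zero] at h
  have h1 := (hlim D₀ (1 - α) (by linarith)).eventually_le_const (by norm_num : (0 : ℝ) < 1)
  have h2 := (hlim (Real.exp 1 * 3 ^ k * D₀ ^ ((k : ℝ) - (1 + δ))) (1 + ε)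
    (by linarith)).eventually_le_const (by norm_num : (0 : ℝ) < 1 / 2)
  have h3 : ∀ᶠ a : ℝ in 𝓝[>] 0, a ∈ Set.Ioc (0 : ℝ) 1 := Ioc_mem_nhdsGT (by norm_num)
  obtain ⟨a, ⟨h1, h2⟩, h3⟩ := ((h1.and h2).and h3).exists
  exact ⟨δ, a, hδ0, hδ1, h3.1, h3.2, by nlinarith, h1, h2⟩

/-- The density bound makes the quantity at least log n eventually. Its divergence lets the integer
roundings be absorbed into the constant. -/
theorem tendsto_mul_density_rpow_atTop {m : ℕ → ℕ} {ε : ℝ} (hε : 0 < ε)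
    (hm : ∀ᶠ n in atTop, 0 < m n)
    (h : (fun n : ℕ => (m n : ℝ) / (n : ℝ)) =o[atTop]
      (fun n : ℕ => ((n : ℝ) / Real.log (n : ℝ)) ^ ε)) :
    Tendsto (fun n : ℕ => (n : ℝ) * ((m n : ℝ) / (n : ℝ)) ^ (-1 / ε)) atTop atTop := by
  refine tendsto_atTop_mono' atTop ?_ (Real.tendsto_log_atTop.comp tendsto_natCast_atTop_atTop)
  filter_upwards [hm, h.bound (by norm_num : (0 : ℝ) < 1), eventually_ge_atTop 2] with n hmn hb hn
  have hn' : (1 : ℝ) < n := by exact_mod_cast hn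
  have hm' : (0 : ℝ) < m n := by exact_mod_cast hmn
  have hlog : 0 < Real.log n := Real.log_pos hn'
  have hn0 : (0 : ℝ) < n := by linarith
  have hD : (0 : ℝ) < (m n : ℝ) / n := by positivity
  rw [one_mul, Real.norm_of_nonneg hD.le, Real.norm_of_nonneg (by positivity)] at hb
  have h1 := Real.rpow_le_rpow_of_nonpos hD hb
    (div_nonpos_of_nonpos_of_nonneg (by norm_num : (-1 : ℝ) ≤ 0) hε.le)
  rw [← Real.rpow_mul (by positivity), mul_div_cancel₀ _ hε.ne', Real.rpow_neg_one, inv_div] at h1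
  calc Real.log n = n * (Real.log n / n) := by field_simp
    _ ≤ _ := mul_le_mul_of_nonneg_left h1 hn0.le

theorem IsExpander.exp_le_treeLikeSize {n m : ℕ} {Φ : CNF n m} {δ c X : ℝ} (hδ : 0 < δ)
    (hX : 2 * (1 + δ) ≤ δ * c * X) (h : IsExpander Φ ⌊c * X⌋₊ δ) :
    ENNReal.ofReal (Real.exp (Real.log 2 * (δ * c) / 2 * X)) ≤
      ((treeLikeSize Φ : ℕ∞) : ENNReal) := by
  set r := ⌊c * X⌋₊
  have hr : c * X < r + 1 := Nat.lt_floor_add_one _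
  have hδr : 0 < δ * r := by nlinarith
  -- The largest `t` strictly below δr. Both roundings lose at most 1 + δ in total, which `hX`
  -- bounds by half of δcX.
  obtain ⟨t, ht⟩ : ∃ t : ℕ, ⌈δ * r⌉₊ = t + 1 :=
    Nat.exists_eq_succ_of_ne_zero (Nat.ceil_pos.2 hδr).ne'
  have ht1 : (t : ℝ) < δ * r := Nat.lt_ceil.1 (by omega)
  have ht2 : δ * r ≤ t + 1 := by
    have := Nat.le_ceil (δ * r)
    rw [ht] at this
    exact_mod_cast this
  have hlog : 0 < Real.log 2 := Real.log_pos (by norm_num)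
  have hexp : Real.exp (Real.log 2 * (δ * c) / 2 * X) ≤ ((2 ^ t : ℕ) : ℝ) := by
    push_cast
    rw [← Real.rpow_natCast, Real.rpow_def_of_pos (by norm_num), Real.exp_le_exp]
    have : δ * c * X / 2 ≤ t := by nlinarith
    calc _ = Real.log 2 * (δ * c * X / 2) := by ring
      _ ≤ _ := mul_le_mul_of_nonneg_left this hlog.le
  have h2 := h.two_pow_le_treeLikeSize hδ ht1
  calc ENNReal.ofReal _ ≤ ENNReal.ofReal ((2 ^ t : ℕ) : ℝ) := ENNReal.ofReal_le_ofReal hexp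
    _ = (((2 ^ t : ℕ) : ℕ∞) : ENNReal) := by rw [ENNReal.ofReal_natCast]; rfl
    _ ≤ _ := by exact_mod_cast h2

end PowerLawSAT

theorem mainTheorem5 (k : ℕ) (hk : 3 ≤ k)
    (β : ℝ) (hβ : (2 * (k : ℝ) - 3) / ((k : ℝ) - 2) < β)
    (ε : ℝ) (hε : 0 < ε) (hεβ : ε < ((k : ℝ) - 1) * ((β - 2) / (β - 1)) - 1) :
    ∃ C : ℝ, 0 < C ∧ ∀ m : ℕ → ℕ,
      (fun n : ℕ => (n : ℝ)) =O[atTop] (fun n : ℕ => (m n : ℝ)) →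
      (fun n : ℕ => (m n : ℝ) / (n : ℝ)) =o[atTop]
        (fun n : ℕ => ((n : ℝ) / Real.log (n : ℝ)) ^ ε) →
      (∃ p : ℝ, 0 < p ∧ ∀ᶠ n : ℕ in atTop,
        p ≤ PowerLawSAT.prob k (PowerLawSAT.powerLawWeight β n)
          {Φ : PowerLawSAT.CNF n (m n) | PowerLawSAT.Unsat Φ}) →
      Tendsto
        (fun n : ℕ => PowerLawSAT.prob k (PowerLawSAT.powerLawWeight β n)
          {Φ : PowerLawSAT.CNF n (m n) |
            ENNReal.ofReal (Real.exp (C * ((n : ℝ) * ((m n : ℝ) / (n : ℝ)) ^ (-1 / ε)))) ≤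
              ((PowerLawSAT.treeLikeSize Φ : ℕ∞) : ENNReal)})
        atTop (𝓝 1) ∧
      Tendsto
        (fun n : ℕ =>
          PowerLawSAT.prob k (PowerLawSAT.powerLawWeight β n)
            {Φ : PowerLawSAT.CNF n (m n) | PowerLawSAT.Unsat Φ ∧
              ENNReal.ofReal (Real.exp (C * ((n : ℝ) * ((m n : ℝ) / (n : ℝ)) ^ (-1 / ε)))) ≤
                ((PowerLawSAT.treeLikeSize Φ : ℕ∞) : ENNReal)} /
          PowerLawSAT.prob k (PowerLawSAT.powerLawWeight β n)
            {Φ : PowerLawSAT.CNF n (m n) | PowerLawSAT.Unsat Φ})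
        atTop (𝓝 1) := by
  open PowerLawSAT in
  have hk3 : (3 : ℝ) ≤ k := by exact_mod_cast hk
  have hβ2 : 2 < β := by
    refine lt_trans ?_ hβ
    rw [lt_div_iff₀ (by linarith)]
    linarith
  have hα0 : 0 < 1 / (β - 1) := one_div_pos.2 (by linarith)
  have hα1 : 1 / (β - 1) < 1 := by rw [div_lt_one (by linarith)]; linarith
  have h1α : (β - 2) / (β - 1) = 1 - 1 / (β - 1) := by
    rw [eq_sub_iff_add_eq, ← add_div, div_eq_one_iff_eq (by linarith)]
    ring
  rw [h1α] at hεβ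
  obtain ⟨δ, a, hδ, hδ1, ha, ha1, hexp, hτ1, hK⟩ := exists_union_bound_constants
    (D₀ := 2 * (1 + 1 / (1 - 1 / (β - 1))) * (k : ℝ) ^ (1 - 1 / (β - 1))) hα0 hα1 hε hεβ
  have hc : 0 < a ^ (1 + 1 / ε) := by positivity
  refine ⟨Real.log 2 * (δ * a ^ (1 + 1 / ε)) / 2,
    by have := Real.log_pos (by norm_num : (1 : ℝ) < 2); positivity, fun m hmn hmo hp => ?_⟩
  obtain ⟨p, hp0, hp⟩ := hp
  have hm : ∀ᶠ n in atTop, 0 < m n := by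
    obtain ⟨c, hc⟩ := hmn.bound
    filter_upwards [hc, eventually_gt_atTop 0] with n hn hn0
    by_contra hmn
    have hn0' : (0 : ℝ) < n := by exact_mod_cast hn0
    simp only [not_lt, nonpos_iff_eq_zero] at hmn
    simp only [hmn, Nat.cast_zero, norm_zero, mul_zero, norm_le_zero_iff] at hn
    exact hn0'.ne' hn
  have hX := tendsto_mul_density_rpow_atTop hε hm hmo
  have hbound : ∀ᶠ n : ℕ in atTop, k ≤ n ∧ prob k (powerLawWeight β n)
      {Φ : CNF n (m n) | ENNReal.ofReal (Real.exp (Real.log 2 * (δ * a ^ (1 + 1 / ε)) / 2 *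
        ((n : ℝ) * ((m n : ℝ) / (n : ℝ)) ^ (-1 / ε)))) ≤ ((treeLikeSize Φ : ℕ∞) : ENNReal)}ᶜ ≤
      2 * (n : ℝ) ^ (-δ) := by
    have hnk : Tendsto (fun n : ℕ => (n : ℝ) ^ (1 - 1 / (β - 1))) atTop atTop :=
      (tendsto_rpow_atTop (by linarith)).comp tendsto_natCast_atTop_atTop
    filter_upwards [hm, eventually_ge_atTop k, hnk.eventually_ge_atTop (2 * k),
      (hX.const_mul_atTop (mul_pos hδ hc)).eventually_ge_atTop (2 * (1 + δ))]
      with n hmn hkn hnk hX1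
    refine ⟨hkn, le_trans (prob_mono (powerLawWeight_pos β n) ?_)
      (prob_not_isExpander_powerLaw_le (by omega) hα0 hα1 hε hδ hδ1 ha ha1 hexp rfl hτ1 hK hkn hnk
        hmn)⟩
    intro Φ hΦ hexpander
    exact hΦ (hexpander.exp_le_treeLikeSize hδ hX1)
  -- Used with q = 1 unconditionally and with q = p for the conditional probability.
  have hlim : ∀ q : ℝ, Tendsto (fun n : ℕ => 1 - 2 * (n : ℝ) ^ (-δ) / q) atTop (𝓝 1) := by
    intro q
    have := (((tendsto_rpow_neg_atTop hδ).comp tendsto_natCast_atTop_atTop).const_mul 2).div_const q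
    simpa using this.const_sub 1
  constructor
  · refine tendsto_of_tendsto_of_tendsto_of_le_of_le' (hlim 1) tendsto_const_nhds ?_ ?_
    · filter_upwards [hbound] with n ⟨hkn, hn⟩
      rw [one_sub_prob_compl (powerLawWeight_pos β n) hkn, div_one]
      linarith
    · filter_upwards [eventually_ge_atTop k] with n hkn
      rw [← prob_univ (powerLawWeight_pos β n) hkn]
      exact prob_mono (powerLawWeight_pos β n) (Set.subset_univ _)
  · refine tendsto_of_tendsto_of_tendsto_of_le_of_le' (hlim p) tendsto_const_nhds ?_ ?_
    · filter_upwards [hbound, hp] with n ⟨hkn, hn⟩ hpn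
      have hU := hp0.trans_le hpn
      rw [le_div_iff₀ hU, sub_mul, one_mul]
      have hsplit := prob_inter_add_prob_diff (k := k) (powerLawWeight β n)
        {Φ : CNF n (m n) | Unsat Φ} {Φ : CNF n (m n) |
          ENNReal.ofReal (Real.exp (Real.log 2 * (δ * a ^ (1 + 1 / ε)) / 2 *
          ((n : ℝ) * ((m n : ℝ) / (n : ℝ)) ^ (-1 / ε)))) ≤ ((treeLikeSize Φ : ℕ∞) : ENNReal)}
      have hdiff := (prob_mono (k := k) (powerLawWeight_pos β n) (Set.sdiff_subset_compl
        {Φ : CNF n (m n) | Unsat Φ} {Φ : CNF n (m n) |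
          ENNReal.ofReal (Real.exp (Real.log 2 * (δ * a ^ (1 + 1 / ε)) / 2 *
          ((n : ℝ) * ((m n : ℝ) / (n : ℝ)) ^ (-1 / ε)))) ≤
            ((treeLikeSize Φ : ℕ∞) : ENNReal)})).trans hn
      have hq : 2 * (n : ℝ) ^ (-δ) ≤ 2 * (n : ℝ) ^ (-δ) / p *
          prob k (powerLawWeight β n) {Φ : CNF n (m n) | Unsat Φ} := by
        rw [div_mul_eq_mul_div, le_div_iff₀ hp0]
        exact mul_le_mul_of_nonneg_left hpn (by positivity)
      rw [Set.ofPred_and]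
      linarith
    · filter_upwards with n
      exact div_le_one_of_le₀ (prob_mono (powerLawWeight_pos β n) fun Φ hΦ => hΦ.1)
        (prob_nonneg (powerLawWeight_pos β n) _)
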